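/- Let $\omega_3=e^{2\pi i/3}$ and let $\zeta$ be the Riemann zeta function. Then $\sin(\pi\omega_3^2 n)\neq 0$ for every integer $n\ge 1$ (so all terms below are well defined), the following series of complex numbers converges absolutely, and $$\zeta(3)=\sum_{n=1}^{\infty}\frac{3\pi(-1)^{n-1}\,\omega_3^2\,(1+\omega_3^2 n)(2+\omega_3^2 n)\cdots(n+\omega_3^2 n)}{n!\,n^2\,\sin(\pi\omega_3^2 n)} .$$ -/

import Mathlib

open scoped Nat

/-- The primitive `m`-th root of unity `ω_m = e^{2πi/m}` (used for `m ≥ 1`). -/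
noncomputable def rootOmega (m : ℕ) : ℂ :=
  Complex.exp (2 * Real.pi * Complex.I / m)

/-- The `n`-th term (`n ≥ 1`) of the series,
`3π (-1)^{n-1} ω₃² (1 + ω₃² n)(2 + ω₃² n) ⋯ (n + ω₃² n) / (n! n² sin(π ω₃² n))`. -/
noncomputable def zetaThreeTerm (n : ℕ) : ℂ :=
  3 * Real.pi * (-1) ^ (n - 1) * rootOmega 3 ^ 2 *
      (∏ k ∈ Finset.Icc 1 n, ((k : ℂ) + rootOmega 3 ^ 2 * n)) /
    ((n ! : ℂ) * (n : ℂ) ^ 2 * Complex.sin (Real.pi * rootOmega 3 ^ 2 * n))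

open Filter Topology

/-! Expand the finite product `∏ (1 - z/j³)⁻¹` over `1 ≤ j ≤ N` in partial fractions. Comparing
coefficients of `z` gives `∑ c(N,m)/m³ = ∑ 1/m³` (`sum_cubeCoeff_div`). As `N → ∞` with `m` fixed,
Euler's limit for `Γ` at conjugate multiples of `ω₃`, then reflection, turns `c(N,m)/m³` into the
`m`-th term (`tendsto_cubeCoeff_div`). The uniform bound `|c(N,m)| ≤ 3` allows dominated
convergence. -/

/-- The partial fraction identity for `∏ i ∈ s, (1 - z / x i)⁻¹`, in degree one. -/
theorem sum_inv_mul_prod_div_sub {F ι : Type*} [Field F] [DecidableEq ι] (s : Finset ι)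
    (x : ι → F) (hx : ∀ i ∈ s, x i ≠ 0) (hinj : Set.InjOn x s) :
    ∑ i ∈ s, (x i)⁻¹ * ∏ j ∈ s.erase i, x j / (x j - x i) = ∑ i ∈ s, (x i)⁻¹ := by
  -- `p` vanishes at 0 and equals 1 at each node, so `p/X` is the Lagrange interpolant of `1/x`; it
  -- is then evaluated at 0.
  open Polynomial in
  set p : F[X] := 1 - ∏ j ∈ s, (1 - C (x j)⁻¹ * X) with hp
  have hprod : ∀ t : Finset ι, (∏ j ∈ t, (1 - C (x j)⁻¹ * X)).coeff 0 = 1 ∧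
      (∏ j ∈ t, (1 - C (x j)⁻¹ * X)).coeff 1 = -∑ j ∈ t, (x j)⁻¹ := by
    intro t
    induction t using Finset.induction_on with
    | empty => simp [coeff_one]
    | insert a t ha ih =>
      rw [Finset.prod_insert ha, Finset.sum_insert ha, sub_mul, one_mul, mul_assoc]
      refine ⟨by simp [ih.1], ?_⟩
      rw [coeff_sub, coeff_C_mul, coeff_X_mul, ih.1, ih.2]
      ring
  have hp0 : p.coeff 0 = 0 := by simp [hp, (hprod s).1]
  have hp1 : p.coeff 1 = ∑ i ∈ s, (x i)⁻¹ := by simp [hp, (hprod s).2, coeff_one]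
  have hpX : p.divX * X = p := by simpa [hp0] using p.divX_mul_X_add
  have heval : ∀ i ∈ s, p.divX.eval (x i) = (x i)⁻¹ := by
    intro i hi
    have h1 : p.eval (x i) = 1 := by
      simp only [hp, eval_sub, eval_one, eval_prod, eval_mul, eval_C, eval_X]
      rw [Finset.prod_eq_zero hi (by simp [hx i hi]), sub_zero]
    rw [← hpX, eval_mul, eval_X] at h1
    exact eq_inv_of_mul_eq_one_left h1
  have hdeg : p.divX.degree < s.card := by
    by_cases h0 : p = 0
    · simp [h0]
    · refine (degree_divX_lt h0).trans_le ?_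
      have h2 : (∏ j ∈ s, (1 - C (x j)⁻¹ * X)).natDegree ≤ s.card := by
        refine (natDegree_prod_le _ _).trans ?_
        refine (Finset.sum_le_card_nsmul s _ 1 fun j _ => ?_).trans (by simp)
        compute_degree
      refine degree_le_of_natDegree_le ((natDegree_sub_le _ _).trans ?_)
      simpa using h2
  have key := congrArg (fun q : F[X] => q.eval 0)
    (Lagrange.eq_interpolate_of_eval_eq (r := fun i => (x i)⁻¹) hinj hdeg heval)
  simp only [Lagrange.interpolate_apply, eval_finsetSum, eval_mul, eval_C, Lagrange.basis,
    eval_prod, Lagrange.basisDivisor, eval_sub, eval_X] at key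
  rw [← coeff_zero_eq_eval_zero, coeff_divX, zero_add, hp1] at key
  rw [key]
  refine Finset.sum_congr rfl fun i _ => congrArg _ (Finset.prod_congr rfl fun j _ => ?_)
  rw [← neg_sub (x i) (x j), div_neg, div_eq_mul_inv]
  ring

/-- The coefficient of the pole at `(k + 1) ^ 3` in the partial fraction expansion of
`∏ j ∈ Finset.range N, (1 - z / (j + 1) ^ 3)⁻¹`, see `prod_erase_cube_eq_cubeCoeff`. -/
noncomputable def cubeCoeff (N k : ℕ) : ℝ :=
  3 * (-1) ^ k * N.choose (k + 1) * ∏ j ∈ Finset.range N,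
    ((j : ℝ) + 1) ^ 2 / (((j : ℝ) + 1) ^ 2 + (j + 1) * (k + 1) + (k + 1) ^ 2)

theorem prod_range_div_sub_self (k : ℕ) :
    ∏ j ∈ Finset.range k, ((j : ℝ) + 1) / (j - k) = (-1) ^ k := by
  have h : ∏ j ∈ Finset.range k, ((j : ℝ) + 1) = ∏ j ∈ Finset.range k, ((k : ℝ) - j) := by
    rw [← Finset.prod_range_reflect]
    refine Finset.prod_congr rfl fun j hj => ?_
    have := Finset.mem_range.1 hj
    rw [Nat.sub_sub, Nat.cast_sub (by omega)]
    push_cast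
    ring
  rw [Finset.prod_div_distrib, h, ← Finset.prod_div_distrib]
  rw [Finset.prod_congr rfl (g := fun _ => (-1 : ℝ)), Finset.prod_const, Finset.card_range]
  intro j hj
  have : (j : ℝ) - k ≠ 0 := by
    rw [sub_ne_zero]
    exact_mod_cast (Finset.mem_range.1 hj).ne
  rw [div_eq_iff this]
  ring

theorem prod_erase_div_sub (N k : ℕ) (hk : k < N) :
    ∏ j ∈ (Finset.range N).erase k, ((j : ℝ) + 1) / (j - k) = (-1) ^ k * N.choose (k + 1) := by
  induction N, Nat.succ_le_of_lt hk using Nat.le_induction with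
  | base =>
    rw [Finset.range_add_one, Finset.erase_insert (by simp), prod_range_div_sub_self]
    simp
  | succ N hN ih =>
    have hkN : k < N := hN
    rw [Finset.range_add_one, Finset.erase_insert_of_ne hkN.ne', Finset.prod_insert (by simp),
      ih hkN]
    have h := Nat.choose_mul_succ_eq N (k + 1)
    rw [Nat.add_sub_add_right] at h
    have h' : (N.choose (k + 1) : ℝ) * (N + 1) = (N + 1).choose (k + 1) * (N - k) := by
      rw [← Nat.cast_sub hkN.le]
      exact_mod_cast h
    have : (N : ℝ) - k ≠ 0 := by
      rw [sub_ne_zero]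
      exact_mod_cast hkN.ne'
    field_simp
    linear_combination h'

/-- Factor `a³ - b³ = (a - b)(a² + ab + b²)`: the linear factors give the signed binomial. The
factor 3 in `cubeCoeff` cancels the `1/3` from the extra index `j = k`. -/
theorem prod_erase_cube_eq_cubeCoeff {N k : ℕ} (hk : k < N) :
    ∏ j ∈ (Finset.range N).erase k,
      ((j : ℝ) + 1) ^ 3 / (((j : ℝ) + 1) ^ 3 - ((k : ℝ) + 1) ^ 3) = cubeCoeff N k := by
  rw [cubeCoeff, ← Finset.mul_prod_erase _ _ (Finset.mem_range.2 hk), mul_assoc 3,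
    ← prod_erase_div_sub N k hk]
  have h3 : ((k : ℝ) + 1) ^ 2 / (((k : ℝ) + 1) ^ 2 + (k + 1) * (k + 1) + (k + 1) ^ 2) = 1 / 3 := by
    field_simp
    norm_num
  rw [h3]
  have : ∀ a b : ℝ, 3 * a * (1 / 3 * b) = a * b := fun a b => by ring
  rw [this, ← Finset.prod_mul_distrib]
  refine Finset.prod_congr rfl fun j hj => ?_
  rw [div_mul_div_comm]
  congr 1 <;> ring

theorem sum_cubeCoeff_div (N : ℕ) :
    ∑ k ∈ Finset.range N, cubeCoeff N k / ((k : ℝ) + 1) ^ 3 =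
      ∑ k ∈ Finset.range N, 1 / ((k : ℝ) + 1) ^ 3 := by
  have h := sum_inv_mul_prod_div_sub (Finset.range N) (fun j : ℕ => ((j : ℝ) + 1) ^ 3)
    (fun j _ => by positivity) (fun i _ j _ hij => by
      have := (pow_left_inj₀ (by positivity) (by positivity) (by norm_num)).1 hij
      exact_mod_cast add_right_cancel this)
  simp only [one_div]
  rw [← h]
  refine Finset.sum_congr rfl fun k hk => ?_
  rw [← prod_erase_cube_eq_cubeCoeff (Finset.mem_range.1 hk), div_eq_mul_inv, mul_comm]

/-- With `a = N + 1`, each step multiplies by `a(a + m)/(a² + am + m²) ≤ 1`. With `N.choose m`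
instead, the ratio `a³/(a³ - m³)` would exceed 1 for `a > m > 0`. -/
theorem choose_mul_prod_le_one (N m : ℕ) :
    ((N + m).choose m : ℝ) * ∏ j ∈ Finset.range N,
      ((j : ℝ) + 1) ^ 2 / (((j : ℝ) + 1) ^ 2 + (j + 1) * m + (m : ℝ) ^ 2) ≤ 1 := by
  induction N with
  | zero => simp
  | succ N ih =>
    have h := Nat.choose_mul_succ_eq (N + m) m
    have hs : N + m + 1 - m = N + 1 := by omega
    rw [hs] at h
    have h' : ((N + 1 + m).choose m : ℝ) = (N + m).choose m * (N + m + 1) / (N + 1) := by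
      rw [eq_div_iff (by positivity), add_right_comm]
      exact_mod_cast h.symm
    rw [Finset.prod_range_succ, h']
    have hle : ((N : ℝ) + m + 1) / (N + 1) *
        (((N : ℝ) + 1) ^ 2 / (((N : ℝ) + 1) ^ 2 + (N + 1) * m + (m : ℝ) ^ 2)) ≤ 1 := by
      rw [div_mul_div_comm, div_le_one (by positivity)]
      have : 0 ≤ ((N : ℝ) + 1) * (m : ℝ) ^ 2 := by positivity
      nlinarith
    calc _ = (((N + m).choose m : ℝ) * ∏ j ∈ Finset.range N,
          ((j : ℝ) + 1) ^ 2 / (((j : ℝ) + 1) ^ 2 + (j + 1) * m + (m : ℝ) ^ 2)) *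
          (((N : ℝ) + m + 1) / (N + 1) *
          (((N : ℝ) + 1) ^ 2 / (((N : ℝ) + 1) ^ 2 + (N + 1) * m + (m : ℝ) ^ 2))) := by ring
      _ ≤ 1 := mul_le_one₀ ih (by positivity) hle

theorem abs_cubeCoeff_le (N k : ℕ) : |cubeCoeff N k| ≤ 3 := by
  have h := choose_mul_prod_le_one N (k + 1)
  push_cast at h
  set P := ∏ j ∈ Finset.range N,
    ((j : ℝ) + 1) ^ 2 / (((j : ℝ) + 1) ^ 2 + (j + 1) * (k + 1) + (k + 1) ^ 2) with hP
  have hP0 : 0 ≤ P := Finset.prod_nonneg fun j _ => by positivity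
  have hch : (N.choose (k + 1) : ℝ) ≤ (N + (k + 1)).choose (k + 1) := by
    exact_mod_cast Nat.choose_le_choose (k + 1) (Nat.le_add_right N (k + 1))
  rw [cubeCoeff, ← hP]
  simp only [abs_mul, abs_pow, abs_neg, abs_one, one_pow, mul_one, Nat.abs_ofNat, Nat.abs_cast,
    abs_of_nonneg hP0]
  nlinarith [mul_le_mul_of_nonneg_right hch hP0]

theorem tendsto_choose_div_pow (m : ℕ) :
    Tendsto (fun N : ℕ => (N.choose m : ℝ) / (N : ℝ) ^ m) atTop (𝓝 (1 / (m.factorial : ℝ))) := by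
  have hz : ∀ᶠ N : ℕ in atTop, ((N : ℝ) ^ m / m.factorial) ≠ 0 := by
    filter_upwards [eventually_ne_atTop 0] with N hN
    positivity
  have h := ((Asymptotics.isEquivalent_iff_tendsto_one hz).1 (isEquivalent_choose m)).div_const
    (m.factorial : ℝ)
  refine h.congr' ?_
  filter_upwards [eventually_ne_atTop 0] with N hN
  simp only [Pi.div_apply]
  field_simp

/-- `w` and `-1 - w` are the primitive cube roots of unity, so `(j - wm)(j - (-1 - w)m) = j² + jm +
m²`. -/
theorem GammaSeq_neg_mul_GammaSeq_neg {w : ℂ} (hw : w ^ 2 + w + 1 = 0) {N m : ℕ}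
    (hN : N ≠ 0) (hm : m ≠ 0) :
    Complex.GammaSeq (-(w * m)) N * Complex.GammaSeq (-((-1 - w) * m)) N =
      (N : ℂ) ^ m / (m : ℂ) ^ 2 * ∏ j ∈ Finset.range N,
        ((j : ℂ) + 1) ^ 2 / (((j : ℂ) + 1) ^ 2 + (j + 1) * m + (m : ℂ) ^ 2) := by
  have hN' : (N : ℂ) ≠ 0 := by exact_mod_cast hN
  have hm' : (m : ℂ) ≠ 0 := by exact_mod_cast hm
  rw [Complex.GammaSeq, Complex.GammaSeq, div_mul_div_comm, ← Finset.prod_mul_distrib,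
    Finset.prod_range_succ', Finset.prod_div_distrib, div_mul_div_comm]
  congr 1
  · rw [mul_mul_mul_comm, ← Complex.cpow_add _ _ hN']
    have : -(w * m) + -((-1 - w) * m) = ((m : ℕ) : ℂ) := by ring
    rw [this, Complex.cpow_natCast, Finset.prod_pow, ← Finset.prod_range_add_one_eq_factorial]
    push_cast
    ring
  · rw [mul_comm]
    congr 1
    · push_cast
      linear_combination (-(m : ℂ) ^ 2) * hw
    · refine Finset.prod_congr rfl fun j _ => ?_
      push_cast
      linear_combination (-(m : ℂ) ^ 2) * hw

theorem sin_pi_mul_natCast_ne_zero {w : ℂ} (hw : w ^ 2 + w + 1 = 0) {m : ℕ} (hm : m ≠ 0) :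
    Complex.sin (Real.pi * w * m) ≠ 0 := by
  rw [Complex.sin_ne_zero_iff]
  intro q hq
  have hm' : (m : ℂ) ≠ 0 := by exact_mod_cast hm
  have hpi : (Real.pi : ℂ) ≠ 0 := by exact_mod_cast Real.pi_ne_zero
  have h : w * m = q := mul_left_cancel₀ hpi (by linear_combination hq)
  have h2 : (q : ℂ) ^ 2 + q * m + (m : ℂ) ^ 2 = 0 := by
    rw [← h]
    linear_combination (m : ℂ) ^ 2 * hw
  have h3 : q ^ 2 + q * m + (m : ℤ) ^ 2 = 0 := by exact_mod_cast h2
  have h4 : 0 < (m : ℤ) := by positivity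
  -- The form `q² + qm + m²` is positive definite.
  nlinarith [sq_nonneg (2 * q + m)]

theorem Gamma_natCast_add (s : ℂ) (hs : ∀ n : ℕ, s + n ≠ 0) (m : ℕ) :
    Complex.Gamma (s + m) = (∏ j ∈ Finset.range m, (s + j)) * Complex.Gamma s := by
  induction m with
  | zero => simp
  | succ m ih =>
    rw [Finset.prod_range_succ, Nat.cast_add_one, ← add_assoc, Complex.Gamma_add_one _ (hs m), ih]
    ring

/-- Since `-(-1 - w)m = wm + m`, the functional equation reduces this to reflection for `Γ(-wm)Γ(1 +
wm)`. -/
theorem Gamma_neg_mul_Gamma_neg {w : ℂ} (hw : w ^ 2 + w + 1 = 0) {m : ℕ} (hm : m ≠ 0) :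
    Complex.Gamma (-(w * m)) * Complex.Gamma (-((-1 - w) * m)) =
      Real.pi * w * (∏ j ∈ Finset.Icc 1 m, ((j : ℂ) + w * m)) /
        (m * Complex.sin (Real.pi * w * m)) := by
  have hm' : (m : ℂ) ≠ 0 := by exact_mod_cast hm
  have hsin := sin_pi_mul_natCast_ne_zero hw hm
  have hw0 : w ≠ 0 := by
    rintro rfl
    simp at hw
  have hs : ∀ n : ℕ, w * m + n ≠ 0 := by
    intro n hn
    refine hsin ?_
    rw [show (Real.pi : ℂ) * w * m = -(n * Real.pi) by linear_combination (Real.pi : ℂ) * hn,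
      Complex.sin_neg, Complex.sin_nat_mul_pi, neg_zero]
  have h0 : w * m ≠ 0 := mul_ne_zero hw0 hm'
  have hrefl := Complex.Gamma_mul_Gamma_one_sub (-(w * m))
  rw [show 1 - -(w * m) = w * m + 1 by ring, Complex.Gamma_add_one _ h0,
    show (Real.pi : ℂ) * -(w * m) = -(Real.pi * w * m) by ring, Complex.sin_neg, div_neg,
    eq_neg_iff_add_eq_zero] at hrefl
  have hprod : (w * m) * ∏ j ∈ Finset.Icc 1 m, ((j : ℂ) + w * m) =
      (∏ j ∈ Finset.range m, (w * m + j)) * (w * m + m) := by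
    rw [← Finset.prod_range_succ (fun j : ℕ => w * (m : ℂ) + j), Finset.prod_range_succ',
      Finset.range_eq_Ico, Finset.prod_Ico_add' (fun j : ℕ => w * (m : ℂ) + j) 0 m 1]
    simp only [Nat.cast_zero, zero_add, add_comm (w * (m : ℂ))]
    rw [mul_comm]
    rfl
  rw [show -((-1 - w) * m) = w * m + m by ring, Gamma_natCast_add _ hs]
  rw [eq_div_iff (mul_ne_zero hm' hsin)]
  have hrefl' : Complex.Gamma (-(w * m)) * (w * m * Complex.Gamma (w * m)) *
      Complex.sin (Real.pi * w * m) = -Real.pi := by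
    rw [eq_neg_of_add_eq_zero_left hrefl]
    field_simp
  apply mul_left_cancel₀ hw0
  set P := ∏ j ∈ Finset.range m, (w * (m : ℂ) + j)
  set Q := ∏ j ∈ Finset.Icc 1 m, ((j : ℂ) + w * m)
  apply mul_left_cancel₀ hm'
  linear_combination (P * m) * hrefl' - (Real.pi * w) * hprod - (Real.pi * P * m) * hw

theorem rootOmega_three_sq : (rootOmega 3 ^ 2) ^ 2 + rootOmega 3 ^ 2 + 1 = 0 := by
  have h : IsPrimitiveRoot (rootOmega 3) 3 := by
    simpa [rootOmega] using Complex.isPrimitiveRoot_exp 3 (by norm_num)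
  have h1 := h.geom_sum_eq_zero (by norm_num)
  simp only [Finset.sum_range_succ, Finset.sum_range_zero, pow_zero, pow_one, zero_add] at h1
  linear_combination h1 + rootOmega 3 * h.pow_eq_one

theorem tendsto_cubeCoeff_div (k : ℕ) :
    Tendsto (fun N : ℕ => ((cubeCoeff N k / ((k : ℝ) + 1) ^ 3 : ℝ) : ℂ)) atTop
      (𝓝 (zetaThreeTerm (k + 1))) := by
  have hw := rootOmega_three_sq
  have hk : (k : ℂ) + 1 ≠ 0 := by exact_mod_cast k.succ_ne_zero
  have h1 := (Complex.continuous_ofReal.tendsto _).comp (tendsto_choose_div_pow (k + 1))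
  have h2 := (Complex.GammaSeq_tendsto_Gamma (-(rootOmega 3 ^ 2 * (k + 1 : ℕ)))).mul
    (Complex.GammaSeq_tendsto_Gamma (-((-1 - rootOmega 3 ^ 2) * (k + 1 : ℕ))))
  -- The powers `N^m` cancel, and `m⁻³` splits as `m⁻¹` here and `m⁻²` from the `Γ` product.
  have h3 := (h1.mul h2).const_mul (3 * (-1) ^ k / ((k : ℂ) + 1))
  rw [Gamma_neg_mul_Gamma_neg hw k.succ_ne_zero] at h3
  refine (h3.congr' ?_).trans_eq ?_
  · filter_upwards [eventually_ne_atTop 0] with N hN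
    have hN' : (N : ℂ) ≠ 0 := by exact_mod_cast hN
    rw [GammaSeq_neg_mul_GammaSeq_neg hw hN k.succ_ne_zero, cubeCoeff]
    simp only [Function.comp_apply]
    push_cast
    field_simp
  · congr 1
    rw [zetaThreeTerm]
    have hf : (((k + 1).factorial : ℕ) : ℂ) ≠ 0 := by exact_mod_cast (k + 1).factorial_ne_zero
    have hsin := sin_pi_mul_natCast_ne_zero hw k.succ_ne_zero
    rw [Nat.add_sub_cancel]
    push_cast at hsin ⊢
    field_simp

theorem summable_one_div_succ_cube : Summable fun k : ℕ => 1 / ((k : ℝ) + 1) ^ 3 := by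
  have := (summable_nat_add_iff 1).2 (Real.summable_one_div_nat_pow.2 (by norm_num : 1 < 3))
  simpa using this

theorem norm_cubeCoeff_div_le (N k : ℕ) :
    ‖((cubeCoeff N k / ((k : ℝ) + 1) ^ 3 : ℝ) : ℂ)‖ ≤ 3 * (1 / ((k : ℝ) + 1) ^ 3) := by
  rw [Complex.norm_real, Real.norm_eq_abs, abs_div,
    abs_of_pos (by positivity : 0 < ((k : ℝ) + 1) ^ 3), mul_one_div]
  gcongr
  exact abs_cubeCoeff_le N k

theorem proposition1 :
    (∀ n : ℕ, 1 ≤ n → Complex.sin (Real.pi * rootOmega 3 ^ 2 * n) ≠ 0) ∧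
      HasSum (fun k : ℕ => zetaThreeTerm (k + 1)) (riemannZeta 3) := by
  refine ⟨fun n hn => sin_pi_mul_natCast_ne_zero rootOmega_three_sq (by omega), ?_⟩
  have hbound := summable_one_div_succ_cube.mul_left 3
  -- The limit terms inherit the uniform bound `3/m³`.
  have hsum : Summable fun k : ℕ => zetaThreeTerm (k + 1) :=
    Summable.of_norm_bounded hbound fun k =>
      le_of_tendsto (tendsto_cubeCoeff_div k).norm (Eventually.of_forall fun N =>
        norm_cubeCoeff_div_le N k)
  have hlim := tendsto_tsum_of_dominated_convergence hbound tendsto_cubeCoeff_div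
    (Eventually.of_forall norm_cubeCoeff_div_le)
  have hfin : ∀ N : ℕ, ∑' k : ℕ, ((cubeCoeff N k / ((k : ℝ) + 1) ^ 3 : ℝ) : ℂ) =
      ((∑ k ∈ Finset.range N, 1 / ((k : ℝ) + 1) ^ 3 : ℝ) : ℂ) := by
    intro N
    rw [← sum_cubeCoeff_div, Complex.ofReal_sum, tsum_eq_sum]
    intro k hk
    have : N < k + 1 := by simpa [Nat.lt_succ_iff] using hk
    -- The binomial vanishes beyond `N`, so the series is a finite sum.
    simp [cubeCoeff, Nat.choose_eq_zero_of_lt this]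
  simp only [hfin] at hlim
  have hzeta : riemannZeta 3 = ((∑' k : ℕ, 1 / ((k : ℝ) + 1) ^ 3 : ℝ) : ℂ) := by
    have h := zeta_nat_eq_tsum_of_gt_one (by norm_num : 1 < 3)
    have hs : Summable fun n : ℕ => 1 / (n : ℂ) ^ 3 := by
      simpa using Complex.summable_ofReal.2
        (Real.summable_one_div_nat_pow.2 (by norm_num : 1 < 3))
    rw [hs.tsum_eq_zero_add] at h
    push_cast at h ⊢
    simpa using h
  have hlim' := (Complex.continuous_ofReal.tendsto _).comp
    summable_one_div_succ_cube.hasSum.tendsto_sum_nat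
  rw [hzeta, tendsto_nhds_unique hlim' hlim]
  exact hsum.hasSum
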